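/- Let $(\mathscr{C},\mathbb{E},\mathfrak{s})$ be a Krull--Schmidt extriangulated category (in the sense of Nakaoka--Palu) with enough projectives and enough injectives which satisfies condition (WIC): if $gf$ is an inflation then so is $f$, and if $gf$ is a deflation then so is $g$. A *subcategory* means a full additive subcategory closed under isomorphisms and direct summands, and $\mathbb{E}^{i+1}(X,Y)=\mathbb{E}(\Omega^{i}X,Y)$ for $i\ge 0$ denote the higher extension groups. Notation. For a class $\omega$ of objects of $\mathscr{C}$: * $\omega^{\perp}=\{Y\mid \mathbb{E}^i(X,Y)=0\ \forall i\ge 1,\ \forall X\in\omega\}$ and ${}^{\perp}\omega=\{Y\mid \mathbb{E}^i(Y,X)=0\ \forall i\ge 1,\ \forall X\in\omega\}$; $\omega$ is *self-orthogonal* if $\omega\subseteq\omega^\perp$. * $\hat\omega$ (resp. $\check\omega$) is the class of objects $M$ admitting, for some $n\ge 0$, an $\mathbb{E}$-triangle sequence $W_n\to\cdots\to W_0\to M$ (resp. $M\to W^0\to\cdots\to W^n$) with all $W_i\in\omega$ (resp. $W^i\in\omega$), i.e. a sequence spliced from $\mathbb{E}$-triangles; for $n=0$ this means $M\in\omega$.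 * ${}_\omega\mathcal{X}$ is the class of objects $M$ for which there are $\mathbb{E}$-triangles $K_{n+1}\to W_n\to K_n\dashrightarrow$ ($n\ge 0$) with $K_0=M$, $W_n\in\omega$ and $K_n\in\omega^{\perp}$. Given subcategories $\mathcal{C}$ and $\mathcal{T}$, $\mathcal{T}$ is *$\mathcal{C}$-tilting* if $\mathcal{C}$ and $\mathcal{T}$ are self-orthogonal, $\mathcal{T}\subseteq\hat{\mathcal{C}}$ and $\mathcal{C}\subseteq\check{\mathcal{T}}$. Let $\mathcal{C}$ be a self-orthogonal subcategory such that: 1. ${}_{\mathcal C}\mathcal X$ has a relative injective cogenerator, i.e. there is a subcategory $\mathcal{I}\subseteq{}_{\mathcal C}\mathcal X\cap({}_{\mathcal C}\mathcal X)^{\perp}$ such that every $Y\in{}_{\mathcal C}\mathcal X$ has an $\mathbb{E}$-triangle $Y\to I\to Y'\dashrightarrow$ with $I\in\mathcal{I}$ and $Y'\in{}_{\mathcal C}\mathcal X$; 2. $\check{({}_{\mathcal C}\mathcal X)}$ is finitely filtered, i.e. it contains a finite set $\mathcal{S}$ of objects such that for every object $M$ of it there are $n\ge 1$ and $\mathbb{E}$-triangles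 $M_{i-1}\to M_i\to S_i\dashrightarrow$ ($1\le i\le n$) with $M_0=0$, $M_n=M$ and all $S_i\in\mathcal{S}$. Let $\mathcal{D}\subseteq{}_{\mathcal C}\mathcal X$ be a subcategory such that: 3. $\mathcal{D}$ is relative coresolving in ${}_{\mathcal C}\mathcal X$, i.e. closed under extensions, direct summands and cones of inflations, and containing every injective object of ${}_{\mathcal C}\mathcal X$ (an object $I\in{}_{\mathcal C}\mathcal X$ such that for each $\mathbb{E}$-triangle $A\xrightarrow{x}B\to Z\dashrightarrow$ with $A,B,Z\in{}_{\mathcal C}\mathcal X$ every morphism $A\to I$ factors through $x$); 4. $\mathcal{D}$ is strongly covariantly finite in ${}_{\mathcal C}\mathcal X$, i.e. every $M\in{}_{\mathcal C}\mathcal X$ has an $\mathbb{E}$-triangle $M\xrightarrow{g}D\to V\dashrightarrow$ with $D\in\mathcal{D}$ and $V\in{}_{\mathcal C}\mathcal X$ in which $g$ is a left $\mathcal{D}$-approximation, i.e. every morphism from $M$ to an object of $\mathcal{D}$ factors through $g$; 5. $\check{\mathcal{D}}=\check{({}_{\mathcal C}\mathcal X)}$. Then $\omega:={}^{\perp}\mathcal{D}\cap\mathcal{D}$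 is a $\mathcal{C}$-tilting subcategory, and $\mathcal{D}={}_{\omega}\mathcal{X}$. -/

import Mathlib

open CategoryTheory CategoryTheory.Limits Opposite

universe w v u

attribute [local instance] hasBinaryBiproducts_of_finite_biproducts

section BifunctorOperations

variable {C : Type u} [Category.{v} C] (E : Cᵒᵖ ⥤ C ⥤ AddCommGrpCat.{w})

/-- The abelian group `E(Z, A)` of `E`-extensions of `Z` by `A`. -/
abbrev EExtension (Z A : C) : Type w := ((E.obj (op Z)).obj A : AddCommGrpCat.{w})

variable {E}

/-- `a_* δ`, that is, `E(Z, a)(δ)`. -/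
def EExtension.push {Z A A' : C} (a : A ⟶ A') (δ : EExtension E Z A) : EExtension E Z A' :=
  ((E.obj (op Z)).map a).hom δ

/-- `c^* δ`, that is, `E(c, A)(δ)`. -/
def EExtension.pull {Z Z' A : C} (c : Z' ⟶ Z) (δ : EExtension E Z A) : EExtension E Z' A :=
  ((E.map c.op).app A).hom δ

/-- The direct sum `δ ⊕ δ'` in `E(Z ⊞ Z', A ⊞ A')`: the element that corresponds to
`(δ, 0, 0, δ')` under biadditivity. -/
noncomputable def EExtension.sum [Preadditive C] [HasBinaryBiproducts C] {Z Z' A A' : C}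
    (δ : EExtension E Z A) (δ' : EExtension E Z' A') : EExtension E (Z ⊞ Z') (A ⊞ A') :=
  ((δ.push (biprod.inl : A ⟶ A ⊞ A')).pull (biprod.fst : Z ⊞ Z' ⟶ Z)) +
    ((δ'.push (biprod.inr : A' ⟶ A ⊞ A')).pull (biprod.snd : Z ⊞ Z' ⟶ Z'))

end BifunctorOperations

/-- The data `(E, s)` making an additive category `C` an extriangulated category in the sense of
Nakaoka and Palu. The predicate `Realizes δ x y` says `s(δ) = [A --x--> B --y--> Z]`. -/
structure ExtriangulatedStructure (C : Type u) [Category.{v} C] [Preadditive C] [HasZeroObject C]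
    [HasFiniteBiproducts C] where
  /-- (ET1): a biadditive functor. -/
  E : Cᵒᵖ ⥤ C ⥤ AddCommGrpCat.{w}
  additive_left : E.Additive
  additive_right : ∀ Z : Cᵒᵖ, (E.obj Z).Additive
  Realizes : ∀ {A B Z : C}, EExtension E Z A → (A ⟶ B) → (B ⟶ Z) → Prop
  /-- `s` assigns to each extension one class of sequences ... -/
  exists_realizes : ∀ {A Z : C} (δ : EExtension E Z A),
    ∃ (B : C) (x : A ⟶ B) (y : B ⟶ Z), Realizes δ x y
  /-- ... which is exactly one full equivalence class. -/
  realizes_iff : ∀ {A B B' Z : C} {δ : EExtension E Z A} {x : A ⟶ B} {y : B ⟶ Z},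
    Realizes δ x y → ∀ (x' : A ⟶ B') (y' : B' ⟶ Z),
      (Realizes δ x' y' ↔ ∃ b : B ≅ B', x ≫ b.hom = x' ∧ b.hom ≫ y' = y)
  /-- (ET2): `s` is a realization. -/
  realization : ∀ {A B Z A' B' Z' : C} {δ : EExtension E Z A} {δ' : EExtension E Z' A'}
    {x : A ⟶ B} {y : B ⟶ Z} {x' : A' ⟶ B'} {y' : B' ⟶ Z'},
    Realizes δ x y → Realizes δ' x' y' →
    ∀ (a : A ⟶ A') (c : Z ⟶ Z'), δ.push a = δ'.pull c →
      ∃ b : B ⟶ B', x ≫ b = a ≫ x' ∧ y ≫ c = b ≫ y'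
  /-- (ET2): `s(0) = 0`. -/
  realizes_zero : ∀ A Z : C,
    Realizes (0 : EExtension E Z A) (biprod.inl : A ⟶ A ⊞ Z) (biprod.snd : A ⊞ Z ⟶ Z)
  /-- (ET2): `s(δ ⊕ δ') = s(δ) ⊕ s(δ')`. -/
  realizes_sum : ∀ {A B Z A' B' Z' : C} {δ : EExtension E Z A} {δ' : EExtension E Z' A'}
    {x : A ⟶ B} {y : B ⟶ Z} {x' : A' ⟶ B'} {y' : B' ⟶ Z'},
    Realizes δ x y → Realizes δ' x' y' →
      Realizes (δ.sum δ') (biprod.map x x') (biprod.map y y')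
  /-- (ET3). -/
  et3 : ∀ {A B Z A' B' Z' : C} {δ : EExtension E Z A} {δ' : EExtension E Z' A'}
    {x : A ⟶ B} {y : B ⟶ Z} {x' : A' ⟶ B'} {y' : B' ⟶ Z'},
    Realizes δ x y → Realizes δ' x' y' →
    ∀ (a : A ⟶ A') (b : B ⟶ B'), x ≫ b = a ≫ x' →
      ∃ c : Z ⟶ Z', δ.push a = δ'.pull c ∧ y ≫ c = b ≫ y'
  /-- The dual of (ET3). -/
  et3_op : ∀ {A B Z A' B' Z' : C} {δ : EExtension E Z A} {δ' : EExtension E Z' A'}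
    {x : A ⟶ B} {y : B ⟶ Z} {x' : A' ⟶ B'} {y' : B' ⟶ Z'},
    Realizes δ x y → Realizes δ' x' y' →
    ∀ (b : B ⟶ B') (c : Z ⟶ Z'), y ≫ c = b ≫ y' →
      ∃ a : A ⟶ A', δ.push a = δ'.pull c ∧ x ≫ b = a ≫ x'
  /-- (ET4): `A --f--> B --f'--> D` and `B --g--> G --g'--> F`. -/
  et4 : ∀ {A B D G F : C} {δ : EExtension E D A} {δ' : EExtension E F B}
    {f : A ⟶ B} {f' : B ⟶ D} {g : B ⟶ G} {g' : G ⟶ F},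
    Realizes δ f f' → Realizes δ' g g' →
    ∃ (H : C) (h : A ⟶ G) (h' : G ⟶ H) (d : D ⟶ H) (e : H ⟶ F) (δ'' : EExtension E H A),
      f ≫ g = h ∧ f' ≫ d = g ≫ h' ∧ h' ≫ e = g' ∧
      Realizes δ'' h h' ∧ Realizes (δ'.push f') d e ∧
      δ''.pull d = δ ∧ δ''.push f = δ'.pull e
  /-- The dual of (ET4): `D --f'--> A --f--> B` and `F --g'--> B --g--> G`. -/
  et4_op : ∀ {A B D G F : C} {δ : EExtension E B D} {δ' : EExtension E G F}
    {f' : D ⟶ A} {f : A ⟶ B} {g' : F ⟶ B} {g : B ⟶ G},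
    Realizes δ f' f → Realizes δ' g' g →
    ∃ (H : C) (h' : H ⟶ A) (h : A ⟶ G) (d : D ⟶ H) (e : H ⟶ F) (δ'' : EExtension E G H),
      f ≫ g = h ∧ e ≫ g' = h' ≫ f ∧ d ≫ h' = f' ∧
      Realizes δ'' h' h ∧ Realizes (δ.pull g') d e ∧
      δ''.push e = δ' ∧ δ.push d = δ''.pull g

/-- Krull-Schmidt: every object is a finite direct sum of objects with local endomorphism ring. -/
def IsKrullSchmidtCategory (C : Type u) [Category.{v} C] [Preadditive C]
    [HasFiniteBiproducts C] : Prop :=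
  ∀ X : C, ∃ (n : ℕ) (f : Fin n → C), (∀ i, IsLocalRing (End (f i))) ∧ Nonempty (X ≅ ⨁ f)

/-- A full additive subcategory closed under isomorphisms and direct summands. -/
structure IsAdditiveSubcategory {C : Type u} [Category.{v} C] [Preadditive C] [HasZeroObject C]
    [HasFiniteBiproducts C] (P : ObjectProperty C) : Prop where
  iso : ∀ {X Y : C}, (X ≅ Y) → P X → P Y
  zero : ∀ {X : C}, IsZero X → P X
  biprod : ∀ {X Y : C}, P X → P Y → P (X ⊞ Y)
  summand : ∀ {X Y : C}, P (X ⊞ Y) → P X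

namespace ExtriangulatedStructure

variable {C : Type u} [Category.{v} C] [Preadditive C] [HasZeroObject C] [HasFiniteBiproducts C]
  (S : ExtriangulatedStructure.{w} C)

/-- There is an `E`-triangle `A → B → Z ⇢`. -/
def ETriangle (A B Z : C) : Prop :=
  ∃ (δ : EExtension S.E Z A) (x : A ⟶ B) (y : B ⟶ Z), S.Realizes δ x y

def Inflation {A B : C} (x : A ⟶ B) : Prop :=
  ∃ (Z : C) (y : B ⟶ Z) (δ : EExtension S.E Z A), S.Realizes δ x y

def Deflation {B Z : C} (y : B ⟶ Z) : Prop :=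
  ∃ (A : C) (x : A ⟶ B) (δ : EExtension S.E Z A), S.Realizes δ x y

/-- The condition (WIC). -/
def WeaklyIdempotentComplete : Prop :=
  (∀ {X Y Z : C} (f : X ⟶ Y) (g : Y ⟶ Z), S.Inflation (f ≫ g) → S.Inflation f) ∧
  (∀ {X Y Z : C} (f : X ⟶ Y) (g : Y ⟶ Z), S.Deflation (f ≫ g) → S.Deflation g)

def IsProjective (P : C) : Prop :=
  ∀ {A B Z : C} (δ : EExtension S.E Z A) (x : A ⟶ B) (y : B ⟶ Z), S.Realizes δ x y →
    ∀ c : P ⟶ Z, ∃ b : P ⟶ B, b ≫ y = c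

def IsInjective (I : C) : Prop :=
  ∀ {A B Z : C} (δ : EExtension S.E Z A) (x : A ⟶ B) (y : B ⟶ Z), S.Realizes δ x y →
    ∀ a : A ⟶ I, ∃ b : B ⟶ I, x ≫ b = a

class EnoughProjectives : Prop where
  presentation : ∀ Z : C, ∃ K P : C, S.IsProjective P ∧ S.ETriangle K P Z

class EnoughInjectives : Prop where
  presentation : ∀ A : C, ∃ I K : C, S.IsInjective I ∧ S.ETriangle A I K

section HigherExtensions

variable [S.EnoughProjectives]

/-- A chosen syzygy `ΩX`, so that there is an `E`-triangle `ΩX → P → X` with `P` projective. -/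
noncomputable def syzygy (X : C) : C := (EnoughProjectives.presentation (S := S) X).choose

/-- The higher extension group `E^{i+1}(X, Y) = E(Ω^i X, Y)`. -/
noncomputable abbrev ExtSucc (i : ℕ) (X Y : C) : Type w := EExtension S.E (S.syzygy^[i] X) Y

/-- `E^i(X, Y) = 0` for all `i ≥ 1`. -/
def ExtVanish (X Y : C) : Prop := ∀ (i : ℕ) (δ : S.ExtSucc i X Y), δ = 0

/-- The right orthogonal `ω^⊥`. -/
def rightPerp (ω : ObjectProperty C) : ObjectProperty C := fun Y => ∀ X, ω X → S.ExtVanish X Y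

/-- The left orthogonal `^⊥ω`. -/
def leftPerp (ω : ObjectProperty C) : ObjectProperty C := fun Y => ∀ X, ω X → S.ExtVanish Y X

def SelfOrthogonal (ω : ObjectProperty C) : Prop := ω ≤ S.rightPerp ω

/-- The class `_ωX`: objects `M` with an `E`-triangle sequence `⋯ → W 1 → W 0 → M`, spliced from
`E`-triangles `K (n+1) → W n → K n` with `K 0 = M`, where `W n ∈ ω` and `K n ∈ ω^⊥`. -/
def ProperResolved (ω : ObjectProperty C) : ObjectProperty C := fun M =>
  ∃ K W : ℕ → C, K 0 = M ∧
    ∀ n, ω (W n) ∧ S.rightPerp ω (K n) ∧ S.ETriangle (K (n + 1)) (W n) (K n)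

end HigherExtensions

/-- `ω̂_n`: objects `M` with an `E`-triangle sequence `W_n → ⋯ → W_0 → M`, all `W_i ∈ ω`. -/
def HatLE (ω : ObjectProperty C) : ℕ → ObjectProperty C
  | 0 => ω
  | n + 1 => fun M => ∃ K W : C, ω W ∧ HatLE ω n K ∧ S.ETriangle K W M

/-- `ω̌_n`: objects `M` with an `E`-triangle sequence `M → W^0 → ⋯ → W^n`, all `W^i ∈ ω`. -/
def CheckLE (ω : ObjectProperty C) : ℕ → ObjectProperty C
  | 0 => ω
  | n + 1 => fun M => ∃ W K : C, ω W ∧ CheckLE ω n K ∧ S.ETriangle M W K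

def Hat (ω : ObjectProperty C) : ObjectProperty C := fun M => ∃ n, S.HatLE ω n M

def Check (ω : ObjectProperty C) : ObjectProperty C := fun M => ∃ n, S.CheckLE ω n M

/-- `(𝒞, 𝒯)` is a tilting pair of subcategories, i.e. `𝒯` is a `𝒞`-tilting subcategory. -/
structure IsTiltingPair [S.EnoughProjectives] (𝒞 𝒯 : ObjectProperty C) : Prop where
  isSubcategory_left : IsAdditiveSubcategory 𝒞
  isSubcategory_right : IsAdditiveSubcategory 𝒯
  selfOrthogonal_left : S.SelfOrthogonal 𝒞
  selfOrthogonal_right : S.SelfOrthogonal 𝒯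
  le_hat : 𝒯 ≤ S.Hat 𝒞
  le_check : 𝒞 ≤ S.Check 𝒯

/-- `M` has a finite `𝒮`-filtration: `E`-triangles `M_{i-1} → M_i → S_i`, `1 ≤ i ≤ n`, with
`M_0 = 0`, `M_n = M` and all `S_i ∈ 𝒮`. -/
inductive FiniteFiltration (𝒮 : Set C) : C → Prop
  | single {Z M T : C} : IsZero Z → T ∈ 𝒮 → S.ETriangle Z M T → FiniteFiltration 𝒮 M
  | step {L M T : C} : FiniteFiltration 𝒮 L → T ∈ 𝒮 → S.ETriangle L M T → FiniteFiltration 𝒮 M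

/-- The subcategory `𝒴` is finitely filtered. -/
def FinitelyFiltered (𝒴 : ObjectProperty C) : Prop :=
  ∃ 𝒮 : Set C, 𝒮.Finite ∧ (∀ T ∈ 𝒮, 𝒴 T) ∧ ∀ M, 𝒴 M → S.FiniteFiltration 𝒮 M

/-- `ℐ` is a relative injective cogenerator of `𝒴`. -/
structure IsRelInjectiveCogenerator [S.EnoughProjectives] (ℐ 𝒴 : ObjectProperty C) : Prop where
  isSubcategory : IsAdditiveSubcategory ℐ
  le : ℐ ≤ 𝒴
  le_rightPerp : ℐ ≤ S.rightPerp 𝒴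
  cogenerates : ∀ Y, 𝒴 Y → ∃ I Y' : C, ℐ I ∧ 𝒴 Y' ∧ S.ETriangle Y I Y'

/-- `I` is an injective object of the subcategory `𝒴`, with respect to the `E`-triangles whose
three terms lie in `𝒴`. -/
def IsRelInjective (𝒴 : ObjectProperty C) (I : C) : Prop :=
  𝒴 I ∧ ∀ {A B Z : C} (δ : EExtension S.E Z A) (x : A ⟶ B) (y : B ⟶ Z), S.Realizes δ x y →
    𝒴 A → 𝒴 B → 𝒴 Z → ∀ a : A ⟶ I, ∃ b : B ⟶ I, x ≫ b = a

/-- `𝒟` is a relative coresolving subcategory of `𝒴`. -/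
structure IsRelCoresolving (𝒟 𝒴 : ObjectProperty C) : Prop where
  isSubcategory : IsAdditiveSubcategory 𝒟
  le : 𝒟 ≤ 𝒴
  extension : ∀ {A B Z : C}, S.ETriangle A B Z → 𝒟 A → 𝒟 Z → 𝒟 B
  cone : ∀ {A B Z : C}, S.ETriangle A B Z → 𝒟 A → 𝒟 B → 𝒟 Z
  injective : ∀ I, S.IsRelInjective 𝒴 I → 𝒟 I

/-- `𝒟` is strongly covariantly finite in `𝒴`: each `M ∈ 𝒴` has an `E`-triangle `M → D → V` in `𝒴`
whose first morphism is a left `𝒟`-approximation. -/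
def StronglyCovariantlyFiniteIn (𝒟 𝒴 : ObjectProperty C) : Prop :=
  ∀ M, 𝒴 M → ∃ (D V : C) (δ : EExtension S.E V M) (g : M ⟶ D) (y : D ⟶ V),
    S.Realizes δ g y ∧ 𝒟 D ∧ 𝒴 V ∧ ∀ (D' : C) (g' : M ⟶ D'), 𝒟 D' → ∃ t : D ⟶ D', g ≫ t = g'

end ExtriangulatedStructure

/-! Write 𝒳 for `S.ProperResolved 𝒞`. Everything rests on special approximations: triangles M → D →
V with M in 𝒳, D in 𝒟 and V in 𝒳 ∩ ^⊥𝒟. By Krull–Schmidt and (WIC), a left 𝒟-approximation can be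
made left minimal with its cone still in 𝒳 (`exists_minimal_approximation`). Wakamatsu's lemma
(`Realizes.wakamatsu`) then gives E(V, 𝒟) = 0, and the injective cogenerator, which lies in 𝒟,
carries this to all higher degrees.

The rest is `isTiltingPair_of_special_approximations`. For M in 𝒳 ∩ ^⊥𝒟, iterated special
approximations have all 𝒟-terms in ω; a finite 𝒟-coresolution of M bounds the degrees in which ^⊥𝒟
has extensions by M, so the process stops by splitting. As 𝒞 ⊆ ^⊥𝒟, this gives 𝒞 ⊆ ω̌. Conversely,
the finite filtrations provide one n with E^{n+1}(ω, 𝒳) = 0, so proper 𝒞-resolutions of objects of ω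
split at stage n.

For 𝒟 ⊆ _ωX, a 𝒞-cover of M in 𝒟 is pushed out along a special approximation of its kernel. For the
converse, _ωX lies in 𝒳 by coinduction; the special approximation of M in _ωX splits, because its
cone is in ω̌ and M is in ω^⊥, so M is a summand of an object of 𝒟. -/

open scoped ZeroObject

/-! ### Bifunctoriality and additivity of extensions. -/

namespace EExtension

variable {C : Type u} [Category.{v} C] {E : Cᵒᵖ ⥤ C ⥤ AddCommGrpCat.{w}}

@[simp] lemma push_id {Z A : C} (δ : EExtension E Z A) : δ.push (𝟙 A) = δ := by
  simp [push]

@[simp] lemma pull_id {Z A : C} (δ : EExtension E Z A) : δ.pull (𝟙 Z) = δ := by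
  simp [pull]

lemma push_comp {Z A A' A'' : C} (a : A ⟶ A') (a' : A' ⟶ A'') (δ : EExtension E Z A) :
    δ.push (a ≫ a') = (δ.push a).push a' := by
  simp [push]

lemma pull_comp {Z Z' Z'' A : C} (c : Z' ⟶ Z) (c' : Z'' ⟶ Z') (δ : EExtension E Z A) :
    δ.pull (c' ≫ c) = (δ.pull c).pull c' := by
  simp [pull]

lemma push_pull {Z Z' A A' : C} (a : A ⟶ A') (c : Z' ⟶ Z) (δ : EExtension E Z A) :
    (δ.pull c).push a = (δ.push a).pull c := by
  have h := (E.map c.op).naturality a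
  exact congrArg (fun f => f.hom δ) h.symm

@[simp] lemma push_zero {Z A A' : C} (a : A ⟶ A') : (0 : EExtension E Z A).push a = 0 :=
  map_zero _

@[simp] lemma pull_zero {Z Z' A : C} (c : Z' ⟶ Z) : (0 : EExtension E Z A).pull c = 0 :=
  map_zero _

lemma push_sub {Z A A' : C} (a : A ⟶ A') (δ δ' : EExtension E Z A) :
    (δ - δ').push a = δ.push a - δ'.push a :=
  map_sub _ _ _

lemma pull_sub {Z Z' A : C} (c : Z' ⟶ Z) (δ δ' : EExtension E Z A) :
    (δ - δ').pull c = δ.pull c - δ'.pull c :=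
  map_sub _ _ _

end EExtension

namespace ExtriangulatedStructure

variable {C : Type u} [Category.{v} C] [Preadditive C] [HasZeroObject C] [HasFiniteBiproducts C]
  (S : ExtriangulatedStructure.{w} C)

lemma sub_push {Z A A' : C} (a a' : A ⟶ A') (δ : EExtension S.E Z A) :
    δ.push (a - a') = δ.push a - δ.push a' := by
  have := S.additive_right (op Z)
  simp [EExtension.push, Functor.map_sub]

lemma sub_pull {Z Z' A : C} (c c' : Z' ⟶ Z) (δ : EExtension S.E Z A) :
    δ.pull (c - c') = δ.pull c - δ.pull c' := by
  have := S.additive_left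
  simp [EExtension.pull, Functor.map_sub]

lemma zero_push {Z A A' : C} (δ : EExtension S.E Z A) : δ.push (0 : A ⟶ A') = 0 := by
  have := S.sub_push (0 : A ⟶ A') 0 δ
  simpa using this

lemma zero_pull {Z Z' A : C} (δ : EExtension S.E Z A) : δ.pull (0 : Z' ⟶ Z) = 0 := by
  have := S.sub_pull (0 : Z' ⟶ Z) 0 δ
  simpa using this

variable {S}

/-- A splitting of `A → B → Z` makes it a realization of `0`. -/
lemma realizes_zero_of_split {A B Z : C} (i : A ⟶ B) (r : B ⟶ Z) (p : B ⟶ A) (s : Z ⟶ B)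
    (hip : i ≫ p = 𝟙 A) (hsr : s ≫ r = 𝟙 Z) (hir : i ≫ r = 0) (hpi : p ≫ i + r ≫ s = 𝟙 B) :
    S.Realizes 0 i r := by
  have hsp : s ≫ p = 0 := by
    have h1 : s ≫ (p ≫ i + r ≫ s) ≫ p = s ≫ p := by rw [hpi]; simp
    have h2 : s ≫ (p ≫ i + r ≫ s) ≫ p = s ≫ p + s ≫ p := by
      simp only [Preadditive.comp_add, Preadditive.add_comp, Category.assoc, hip,
        Category.comp_id]
      rw [reassoc_of% hsr]
    rw [h1] at h2
    simpa using h2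
  refine (S.realizes_iff (S.realizes_zero A Z) i r).2
    ⟨⟨biprod.desc i s, biprod.lift p r, ?_, ?_⟩, ?_, ?_⟩
  · ext <;> simp [hip, hsr, hir, hsp]
  · simp [biprod.lift_desc, hpi]
  · simp
  · ext <;> simp [hir, hsr]

lemma realizes_id_left (A : C) : S.Realizes 0 (𝟙 A) (0 : A ⟶ 0) :=
  realizes_zero_of_split _ _ (𝟙 A) 0 (by simp) (by simp) (by simp) (by simp)

lemma realizes_id_right (A : C) : S.Realizes 0 (0 : 0 ⟶ A) (𝟙 A) :=
  realizes_zero_of_split _ _ 0 (𝟙 A) (by simp) (by simp) (by simp) (by simp)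

/-! ### Exact sequences attached to an E-triangle. -/

namespace Realizes

variable {A B Z : C} {δ : EExtension S.E Z A} {x : A ⟶ B} {y : B ⟶ Z}

lemma comp_eq_zero (h : S.Realizes δ x y) : x ≫ y = 0 := by
  obtain ⟨c, -, hc⟩ := S.et3 (realizes_id_left A) h (𝟙 A) x rfl
  simpa using hc.symm

lemma push_eq_zero (h : S.Realizes δ x y) : δ.push x = 0 := by
  obtain ⟨c, hc, -⟩ := S.et3 h (realizes_id_left B) x (𝟙 B) rfl
  simpa using hc

lemma pull_eq_zero (h : S.Realizes δ x y) : δ.pull y = 0 := by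
  obtain ⟨c, hc, -⟩ := S.et3_op (realizes_id_right B) h (𝟙 B) y rfl
  simpa using hc.symm

lemma exists_extend (h : S.Realizes δ x y) {A' : C} (a : A ⟶ A') (ha : δ.push a = 0) :
    ∃ b : B ⟶ A', x ≫ b = a := by
  obtain ⟨b, hb, -⟩ := S.realization h (realizes_id_left A') a 0 (by simpa using ha)
  exact ⟨b, by simpa using hb⟩

lemma exists_lift (h : S.Realizes δ x y) {Z' : C} (c : Z' ⟶ Z) (hc : δ.pull c = 0) :
    ∃ b : Z' ⟶ B, b ≫ y = c := by
  obtain ⟨b, -, hb⟩ := S.realization (realizes_id_right Z') h 0 c (by simpa using hc.symm)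
  exact ⟨b, by simpa using hb.symm⟩

lemma exists_factor_left (h : S.Realizes δ x y) {W : C} (b : W ⟶ B) (hb : b ≫ y = 0) :
    ∃ a : W ⟶ A, a ≫ x = b := by
  obtain ⟨a, -, ha⟩ := S.et3_op (realizes_id_left W) h b 0 (by simpa using hb.symm)
  exact ⟨a, by simpa using ha.symm⟩

lemma exists_factor_right (h : S.Realizes δ x y) {W : C} (b : B ⟶ W) (hb : x ≫ b = 0) :
    ∃ c : Z ⟶ W, y ≫ c = b := by
  obtain ⟨c, -, hc⟩ := S.et3 h (realizes_id_right W) 0 b (by simpa using hb)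
  exact ⟨c, by simpa using hc⟩

lemma exists_pull_eq (h : S.Realizes δ x y) {X : C} (θ : EExtension S.E X A)
    (hθ : θ.push x = 0) : ∃ c : X ⟶ Z, δ.pull c = θ := by
  obtain ⟨G, g, g', hg⟩ := S.exists_realizes θ
  obtain ⟨b, hb⟩ := exists_extend hg x hθ
  obtain ⟨c, hc, -⟩ := S.et3 hg h (𝟙 A) b (by simpa using hb)
  exact ⟨c, by simpa using hc.symm⟩

lemma exists_push_eq (h : S.Realizes δ x y) {Y : C} (θ : EExtension S.E Z Y)
    (hθ : θ.pull y = 0) : ∃ a : A ⟶ Y, δ.push a = θ := by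
  obtain ⟨G, g, g', hg⟩ := S.exists_realizes θ
  obtain ⟨b, hb⟩ := exists_lift hg y hθ
  obtain ⟨a, ha, -⟩ := S.et3_op h hg b (𝟙 Z) (by simpa using hb.symm)
  exact ⟨a, by simpa using ha⟩

/-- By (ET4), `θ.push y` is realized by D → H → X; when it splits, pulling the extension of H by A
back along the section gives the preimage. -/
lemma exists_push_of_push_eq_zero (h : S.Realizes δ x y) {X : C} (θ : EExtension S.E X B)
    (hθ : θ.push y = 0) : ∃ θ' : EExtension S.E X A, θ'.push x = θ := by
  obtain ⟨G, g, g', hg⟩ := S.exists_realizes θ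
  obtain ⟨H, h1, h', d, e, δ'', -, -, -, -, hde, -, hp⟩ := S.et4 h hg
  obtain ⟨s, hs⟩ := exists_lift hde (𝟙 X) (by simpa using hθ)
  refine ⟨δ''.pull s, ?_⟩
  rw [EExtension.push_pull, hp, ← EExtension.pull_comp, hs, EExtension.pull_id]

lemma exists_pull_of_pull_eq_zero (h : S.Realizes δ x y) {Y : C} (θ : EExtension S.E B Y)
    (hθ : θ.pull x = 0) : ∃ θ' : EExtension S.E Z Y, θ'.pull y = θ := by
  obtain ⟨G, g, g', hg⟩ := S.exists_realizes θ
  obtain ⟨H, h1, h', d, e, δ'', -, -, -, -, hde, -, hp⟩ := S.et4_op hg h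
  obtain ⟨r, hr⟩ := exists_extend hde (𝟙 Y) (by simpa using hθ)
  refine ⟨δ''.push r, ?_⟩
  rw [← EExtension.push_pull, ← hp, ← EExtension.push_comp, hr, EExtension.push_id]

variable {A' B' Z' : C} {δ' : EExtension S.E Z' A'} {x' : A' ⟶ B'} {y' : B' ⟶ Z'}

/-- Five lemma by hand: one-sided inverses are first found up to an error factoring through an end
term, and then corrected. -/
lemma isIso_middle (h : S.Realizes δ x y) (h' : S.Realizes δ' x' y') (a : A ⟶ A') (b : B ⟶ B')
    (c : Z ⟶ Z') [IsIso a] [IsIso c] (hδ : δ.push a = δ'.pull c) (hx : x ≫ b = a ≫ x')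
    (hy : y ≫ c = b ≫ y') : IsIso b := by
  have h1 : ∃ s : B' ⟶ B, s ≫ b = 𝟙 B' := by
    obtain ⟨t, ht⟩ := exists_lift h (y' ≫ inv c) (by
      have : (δ.pull (y' ≫ inv c)).push a = 0 := by
        rw [EExtension.push_pull, hδ, ← EExtension.pull_comp]
        simpa using pull_eq_zero h'
      have := congrArg (EExtension.push (inv a)) this
      simpa [← EExtension.push_comp] using this)
    obtain ⟨u, hu⟩ := exists_factor_left h' (𝟙 B' - t ≫ b) (by
      rw [Preadditive.sub_comp, Category.assoc, ← hy, reassoc_of% ht]; simp)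
    refine ⟨t + u ≫ inv a ≫ x, ?_⟩
    simp [hx, hu]
  have h2 : ∃ r : B' ⟶ B, b ≫ r = 𝟙 B := by
    obtain ⟨t, ht⟩ := exists_extend h' (inv a ≫ x) (by
      have : (δ'.push (inv a ≫ x)).pull c = 0 := by
        rw [← EExtension.push_pull, ← hδ, ← EExtension.push_comp]
        simpa using push_eq_zero h
      have := congrArg (EExtension.pull (inv c)) this
      simpa [← EExtension.pull_comp] using this)
    obtain ⟨u, hu⟩ := exists_factor_right h (𝟙 B - b ≫ t) (by
      rw [Preadditive.comp_sub, reassoc_of% hx, ht]; simp)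
    refine ⟨t + y' ≫ inv c ≫ u, ?_⟩
    rw [Preadditive.comp_add, ← reassoc_of% hy]
    simp [hu]
  obtain ⟨s, hs⟩ := h1
  obtain ⟨r, hr⟩ := h2
  have : s = r := by
    calc s = s ≫ b ≫ r := by rw [hr]; simp
      _ = r := by rw [reassoc_of% hs]
  exact ⟨r, hr, by rw [← this, hs]⟩

/-- Any two cones of an inflation are isomorphic. -/
lemma cone_iso {Z' : C} {δ' : EExtension S.E Z' A} {y' : B ⟶ Z'} (h : S.Realizes δ x y)
    (h' : S.Realizes δ' x y') : Nonempty (Z ≅ Z') := by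
  obtain ⟨c, hδ, hy⟩ := S.et3 h h' (𝟙 A) (𝟙 B) (by simp)
  simp only [EExtension.push_id, Category.id_comp] at hδ hy
  have : Mono c := Preadditive.mono_of_cancel_zero c fun {W} z hz => by
    obtain ⟨b, hb⟩ := exists_lift h z (by
      rw [hδ, ← EExtension.pull_comp, hz, S.zero_pull])
    obtain ⟨a, ha⟩ := exists_factor_left h' b (by rw [← hy, reassoc_of% hb, hz])
    rw [← hb, ← ha, Category.assoc, comp_eq_zero h, comp_zero]
  -- A section of `c`: `𝟙 Z' - z ≫ c` kills `δ'`, so it lifts through `y' = y ≫ c`, and this lift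
  -- corrects `z`.
  obtain ⟨z, hz⟩ := exists_pull_eq h δ' (push_eq_zero h')
  obtain ⟨b, hb⟩ := exists_lift h' (𝟙 Z' - z ≫ c) (by
    rw [S.sub_pull, EExtension.pull_comp, ← hδ, hz]; simp)
  have hs : (z + b ≫ y) ≫ c = 𝟙 Z' := by simp [hy, hb]
  have : IsSplitEpi c := ⟨⟨⟨_, hs⟩⟩⟩
  have := isIso_of_mono_of_isSplitEpi c
  exact ⟨asIso c⟩

lemma of_iso_right (h : S.Realizes δ x y) (c : Z ≅ Z') :
    S.Realizes (δ.pull c.inv) x (y ≫ c.hom) := by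
  obtain ⟨B', x', y', h'⟩ := S.exists_realizes (δ.pull c.inv)
  obtain ⟨b, hx, hy⟩ := S.realization h h' (𝟙 A) c.hom (by simp [← EExtension.pull_comp])
  have := isIso_middle h h' (𝟙 A) b c.hom (by simp [← EExtension.pull_comp]) hx hy
  exact (S.realizes_iff h' _ _).2 ⟨(asIso b).symm, by simpa using hx.symm, by simp [hy]⟩

lemma of_iso_left (h : S.Realizes δ x y) (a : A ≅ A') :
    S.Realizes (δ.push a.hom) (a.inv ≫ x) y := by
  obtain ⟨B', x', y', h'⟩ := S.exists_realizes (δ.push a.hom)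
  obtain ⟨b, hx, hy⟩ := S.realization h h' a.hom (𝟙 Z) (by simp)
  have := isIso_middle h h' a.hom b (𝟙 Z) (by simp) hx hy
  refine (S.realizes_iff h' _ _).2 ⟨(asIso b).symm, ?_, by simpa using hy⟩
  rw [Iso.eq_inv_comp, asIso, Iso.symm_hom, ← Category.assoc, ← hx]; simp

end Realizes

end ExtriangulatedStructure

/-! ### E-triangles of objects: composition, pullback, pushout. -/

namespace ExtriangulatedStructure

variable {C : Type u} [Category.{v} C] [Preadditive C] [HasZeroObject C] [HasFiniteBiproducts C]
  {S : ExtriangulatedStructure.{w} C}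

namespace ETriangle

variable {A B Z A' B' Z' : C}

lemma of_iso (h : S.ETriangle A B Z) (a : A ≅ A') (b : B ≅ B') (c : Z ≅ Z') :
    S.ETriangle A' B' Z' := by
  obtain ⟨δ, x, y, h⟩ := h
  have h1 := (h.of_iso_left a).of_iso_right c
  exact ⟨_, _, _, (S.realizes_iff h1 _ (b.inv ≫ y ≫ c.hom)).2 ⟨b, rfl, by simp⟩⟩

lemma biprod (A Z : C) : S.ETriangle A (A ⊞ Z) Z := ⟨_, _, _, S.realizes_zero A Z⟩

lemma id_right (A : C) : S.ETriangle 0 A A := ⟨_, _, _, realizes_id_right A⟩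

lemma sum (h : S.ETriangle A B Z) (h' : S.ETriangle A' B' Z') :
    S.ETriangle (A ⊞ A') (B ⊞ B') (Z ⊞ Z') := by
  obtain ⟨δ, x, y, h⟩ := h
  obtain ⟨δ', x', y', h'⟩ := h'
  exact ⟨_, _, _, S.realizes_sum h h'⟩

/-- (ET4) for objects. -/
lemma comp {A B D G F : C} (h : S.ETriangle A B D) (h' : S.ETriangle B G F) :
    ∃ H, S.ETriangle A G H ∧ S.ETriangle D H F := by
  obtain ⟨δ, x, y, h⟩ := h
  obtain ⟨δ', x', y', h'⟩ := h'
  obtain ⟨H, h1, h1', d, e, δ'', -, -, -, h2, h3, -⟩ := S.et4 h h'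
  exact ⟨H, ⟨_, _, _, h2⟩, ⟨_, _, _, h3⟩⟩

/-- The dual of (ET4) for objects. -/
lemma comp_op {A B D G F : C} (h : S.ETriangle D A B) (h' : S.ETriangle F B G) :
    ∃ H, S.ETriangle H A G ∧ S.ETriangle D H F := by
  obtain ⟨δ, x, y, h⟩ := h
  obtain ⟨δ', x', y', h'⟩ := h'
  obtain ⟨H, h1, h1', d, e, δ'', -, -, -, h2, h3, -⟩ := S.et4_op h h'
  exact ⟨H, ⟨_, _, _, h2⟩, ⟨_, _, _, h3⟩⟩

end ETriangle

lemma Realizes.middle_iso {A B B' Z : C} {δ : EExtension S.E Z A} {x : A ⟶ B} {y : B ⟶ Z}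
    {x' : A ⟶ B'} {y' : B' ⟶ Z} (h : S.Realizes δ x y) (h' : S.Realizes δ x' y') :
    Nonempty (B ≅ B') :=
  have ⟨b, _⟩ := (S.realizes_iff h _ _).1 h'
  ⟨b⟩

/-- A realization of `0` splits. -/
lemma Realizes.exists_split {A B Z : C} {x : A ⟶ B} {y : B ⟶ Z} (h : S.Realizes 0 x y) :
    ∃ (p : B ⟶ A) (s : Z ⟶ B), x ≫ p = 𝟙 A ∧ s ≫ y = 𝟙 Z ∧ s ≫ p = 0 ∧
      p ≫ x + y ≫ s = 𝟙 B := by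
  obtain ⟨b, hx, hy⟩ := (S.realizes_iff (S.realizes_zero A Z) _ _).1 h
  refine ⟨b.inv ≫ biprod.fst, biprod.inr ≫ b.hom, ?_, ?_, ?_, ?_⟩
  · simp [← hx]
  · simp [hy]
  · simp
  · have hy' : y = b.inv ≫ biprod.snd := by simp [← hy]
    have : b.inv ≫ (biprod.fst ≫ biprod.inl + biprod.snd ≫ biprod.inr) ≫ b.hom = 𝟙 B := by
      rw [biprod.total]; simp
    rw [← hx, hy', ← this]
    simp only [Preadditive.comp_add, Preadditive.add_comp, Category.assoc]

/-- Two `E`-triangles ending in `Z` have a common pullback. -/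
lemma ETriangle.exists_pullback {A₁ B₁ A₂ B₂ Z : C} (h₁ : S.ETriangle A₁ B₁ Z)
    (h₂ : S.ETriangle A₂ B₂ Z) : ∃ M, S.ETriangle A₁ M B₂ ∧ S.ETriangle A₂ M B₁ := by
  obtain ⟨δ₁, x₁, y₁, h₁⟩ := h₁
  obtain ⟨δ₂, x₂, y₂, h₂⟩ := h₂
  obtain ⟨M, m, m', hM⟩ := S.exists_realizes (δ₁.pull y₂)
  obtain ⟨H, h', h, d, e, δ, hh, -, -, hδ, hde, he, hd⟩ := S.et4_op hM h₂
  rw [← EExtension.pull_comp, h₂.comp_eq_zero, S.zero_pull] at hde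
  obtain ⟨r, s, hdr, hse, hsr, hrs⟩ := hde.exists_split
  -- `δ.push r` and `δ₁` agree after pullback along `y₂`, so they differ by a push of `δ₂ = δ.push
  -- e`. Changing the retraction by `e ≫ a` makes them equal, and (ET4) along the new splitting then
  -- produces a realization of `δ₁`.
  obtain ⟨a, ha⟩ := h₂.exists_push_eq (δ.push r - δ₁) (by
    rw [EExtension.pull_sub, ← EExtension.push_pull, ← hd, ← EExtension.push_comp, hdr,
      EExtension.push_id, sub_self])
  have hde0 : d ≫ e = 0 := hde.comp_eq_zero
  have hr' : δ.push (r - e ≫ a) = δ₁ := by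
    rw [S.sub_push, EExtension.push_comp, he, ha, sub_sub_cancel]
  have hsplit : S.Realizes 0 (s + a ≫ d) (r - e ≫ a) := by
    refine realizes_zero_of_split _ _ e d ?_ ?_ ?_ ?_
    · simp [hse, hde0]
    · simp [hdr, reassoc_of% hde0]
    · simp [hsr, hdr, reassoc_of% hse, reassoc_of% hde0]
    · rw [← hrs]
      simp only [Preadditive.comp_add, Preadditive.sub_comp, Category.assoc]
      abel
  obtain ⟨H', k, k', d', e', δ'', -, -, -, h3, h4, -⟩ := S.et4 hsplit hδ
  rw [hr'] at h4
  obtain ⟨i⟩ := h4.middle_iso h₁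
  exact ⟨M, ⟨_, _, _, hM⟩, ETriangle.of_iso ⟨_, _, _, h3⟩ (.refl _) (.refl _) i⟩

/-- Two `E`-triangles starting in `A` have a common pushout. -/
lemma ETriangle.exists_pushout {A B₁ Z₁ B₂ Z₂ : C} (h₁ : S.ETriangle A B₁ Z₁)
    (h₂ : S.ETriangle A B₂ Z₂) : ∃ M, S.ETriangle B₁ M Z₂ ∧ S.ETriangle B₂ M Z₁ := by
  obtain ⟨δ₁, x₁, y₁, h₁⟩ := h₁
  obtain ⟨δ₂, x₂, y₂, h₂⟩ := h₂
  obtain ⟨M, m, m', hM⟩ := S.exists_realizes (δ₁.push x₂)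
  obtain ⟨H, h, h', d, e, δ, hh, -, -, hδ, hde, hd, he⟩ := S.et4 h₂ hM
  rw [← EExtension.push_comp, h₂.comp_eq_zero, S.zero_push] at hde
  obtain ⟨r, s, hdr, hse, hsr, hrs⟩ := hde.exists_split
  -- Dual correction: the section `s` is changed by `c ≫ d` so that `δ` pulls back to exactly `δ₁`.
  obtain ⟨c, hc⟩ := h₂.exists_pull_eq (δ.pull s - δ₁) (by
    rw [EExtension.push_sub, EExtension.push_pull, he, ← EExtension.pull_comp, hse,
      EExtension.pull_id, sub_self])
  have hde0 : d ≫ e = 0 := hde.comp_eq_zero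
  have hs' : δ.pull (s - c ≫ d) = δ₁ := by
    rw [S.sub_pull, EExtension.pull_comp, hd, hc, sub_sub_cancel]
  have hsplit : S.Realizes 0 (s - c ≫ d) (r + e ≫ c) := by
    refine realizes_zero_of_split _ _ e d ?_ ?_ ?_ ?_
    · simp [hse, hde0]
    · simp [hdr, reassoc_of% hde0]
    · simp [hsr, hdr, reassoc_of% hse, reassoc_of% hde0]
    · rw [← hrs]
      simp only [Preadditive.comp_sub, Preadditive.add_comp, Category.assoc]
      abel
  obtain ⟨H', k, k', d', e', δ'', -, -, -, h3, h4, -⟩ := S.et4_op hδ hsplit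
  rw [hs'] at h4
  obtain ⟨i⟩ := h4.middle_iso h₁
  exact ⟨M, ETriangle.of_iso ⟨_, _, _, h3⟩ i (.refl _) (.refl _), ⟨_, _, _, hM⟩⟩

/-! ### Vanishing of E and dimension shifting. -/

variable (S) in
/-- `E(X, Y) = 0`. -/
def EVanish (X Y : C) : Prop := ∀ δ : EExtension S.E X Y, δ = 0

namespace EVanish

variable {X X' Y Y' : C}

lemma of_retract_right (h : S.EVanish X Y') (i : Y ⟶ Y') (p : Y' ⟶ Y) (hip : i ≫ p = 𝟙 Y) :
    S.EVanish X Y := fun δ => by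
  rw [← EExtension.push_id δ, ← hip, EExtension.push_comp, h (δ.push i), EExtension.push_zero]

lemma of_retract_left (h : S.EVanish X' Y) (i : X ⟶ X') (p : X' ⟶ X) (hip : i ≫ p = 𝟙 X) :
    S.EVanish X Y := fun δ => by
  rw [← EExtension.pull_id δ, ← hip, EExtension.pull_comp, h (δ.pull p), EExtension.pull_zero]

lemma of_isZero_right (hY : IsZero Y) : S.EVanish X Y := fun δ => by
  rw [← EExtension.push_id δ, hY.eq_of_src (𝟙 Y) 0, S.zero_push]

lemma of_isZero_left (hX : IsZero X) : S.EVanish X Y := fun δ => by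
  rw [← EExtension.pull_id δ, hX.eq_of_src (𝟙 X) 0, S.zero_pull]

lemma of_projective (hX : S.IsProjective X) : S.EVanish X Y := fun δ => by
  obtain ⟨B, x, y, h⟩ := S.exists_realizes δ
  obtain ⟨s, hs⟩ := hX δ x y h (𝟙 X)
  rw [← EExtension.pull_id δ, ← hs, EExtension.pull_comp, h.pull_eq_zero, EExtension.pull_zero]

lemma of_injective (hY : S.IsInjective Y) : S.EVanish X Y := fun δ => by
  obtain ⟨B, x, y, h⟩ := S.exists_realizes δ
  obtain ⟨r, hr⟩ := hY δ x y h (𝟙 Y)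
  rw [← EExtension.push_id δ, ← hr, EExtension.push_comp, h.push_eq_zero, EExtension.push_zero]

lemma middle_right {A B Z : C} (t : S.ETriangle A B Z) (hA : S.EVanish X A) (hZ : S.EVanish X Z) :
    S.EVanish X B := fun θ => by
  obtain ⟨δ, x, y, h⟩ := t
  obtain ⟨θ', rfl⟩ := h.exists_push_of_push_eq_zero θ (hZ _)
  rw [hA θ', EExtension.push_zero]

lemma middle_left {A B Z : C} (t : S.ETriangle A B Z) (hA : S.EVanish A Y) (hZ : S.EVanish Z Y) :
    S.EVanish B Y := fun θ => by
  obtain ⟨δ, x, y, h⟩ := t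
  obtain ⟨θ', rfl⟩ := h.exists_pull_of_pull_eq_zero θ (hA _)
  rw [hZ θ', EExtension.pull_zero]

end EVanish

/-- An `E`-triangle `A → B → Z` with `E(Z, A) = 0` splits. -/
lemma ETriangle.iso_biprod {A B Z : C} (t : S.ETriangle A B Z) (h : S.EVanish Z A) :
    Nonempty (B ≅ A ⊞ Z) := by
  obtain ⟨δ, x, y, t⟩ := t
  obtain rfl := h δ
  exact t.middle_iso (S.realizes_zero A Z)

/-- The horseshoe lemma. -/
lemma ETriangle.horseshoe {A B Z K W K' W' : C} (t : S.ETriangle A B Z) (tA : S.ETriangle K W A)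
    (tZ : S.ETriangle K' W' Z) (h : S.EVanish W' A) :
    ∃ L, S.ETriangle L (W ⊞ W') B ∧ S.ETriangle K L K' := by
  -- The pullback along W' → Z splits as A ⊞ W'; it is covered by W ⊞ W' with kernel K and maps onto
  -- B with kernel K'.
  obtain ⟨M, hM, hM'⟩ := t.exists_pullback tZ
  obtain ⟨i⟩ := hM.iso_biprod h
  have t1 : S.ETriangle K (W ⊞ W') M :=
    (tA.sum (ETriangle.id_right W')).of_iso (isoBiprodZero (isZero_zero C)).symm (.refl _) i.symm
  exact t1.comp_op hM'

/-- `E(ΩX, Y) = 0` if and only if `E(X, ΣY) = 0`. -/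
lemma EVanish.shift_iff {K P X Y I L : C} (tX : S.ETriangle K P X) (hP : S.IsProjective P)
    (tY : S.ETriangle Y I L) (hI : S.IsInjective I) : S.EVanish K Y ↔ S.EVanish X L := by
  obtain ⟨δ, x, y, t⟩ := tX
  obtain ⟨ε, i, q, t'⟩ := tY
  constructor
  · intro h θ
    -- `θ` comes from a morphism K → L; it lifts to I and then extends over P, so it pushes `δ` to
    -- 0.
    obtain ⟨a, rfl⟩ := t.exists_push_eq θ (EVanish.of_projective hP _)
    obtain ⟨b, rfl⟩ := t'.exists_lift a (h _)
    obtain ⟨c, rfl⟩ := hI δ x y t b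
    simp [EExtension.push_comp, t.push_eq_zero]
  · intro h θ
    obtain ⟨a, rfl⟩ := t'.exists_pull_eq θ (EVanish.of_injective hI _)
    obtain ⟨b, rfl⟩ := t.exists_extend a (h _)
    obtain ⟨c, rfl⟩ := hP ε i q t' b
    simp [EExtension.pull_comp, t'.pull_eq_zero]

section Higher

variable (S) in
/-- A chosen cosyzygy. -/
noncomputable def cosyzygy [S.EnoughInjectives] (Y : C) : C :=
  (EnoughInjectives.presentation (S := S) Y).choose_spec.choose

lemma exists_syzygy_triangle [S.EnoughProjectives] (X : C) :
    ∃ P, S.IsProjective P ∧ S.ETriangle (S.syzygy X) P X :=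
  (EnoughProjectives.presentation (S := S) X).choose_spec

lemma exists_cosyzygy_triangle [S.EnoughInjectives] (Y : C) :
    ∃ I, S.IsInjective I ∧ S.ETriangle Y I (S.cosyzygy Y) :=
  ⟨_, (EnoughInjectives.presentation (S := S) Y).choose_spec.choose_spec⟩

variable [S.EnoughProjectives]

lemma EVanish.syzygy_iff [S.EnoughInjectives] {X Y : C} :
    S.EVanish (S.syzygy X) Y ↔ S.EVanish X (S.cosyzygy Y) :=
  have ⟨_, hP, tX⟩ := exists_syzygy_triangle (S := S) X
  have ⟨_, hI, tY⟩ := exists_cosyzygy_triangle (S := S) Y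
  EVanish.shift_iff tX hP tY hI

variable (S) in
/-- `E^{n+1}(X, Y) = 0`. -/
def ExtSuccVanish (n : ℕ) (X Y : C) : Prop := S.EVanish (S.syzygy^[n] X) Y

namespace ExtSuccVanish

variable {X X' Y Y' A B Z : C} {n : ℕ}

lemma of_retract_right (h : S.ExtSuccVanish n X Y') (i : Y ⟶ Y') (p : Y' ⟶ Y)
    (hip : i ≫ p = 𝟙 Y) : S.ExtSuccVanish n X Y :=
  EVanish.of_retract_right h i p hip

lemma of_isZero_right (hY : IsZero Y) : S.ExtSuccVanish n X Y := EVanish.of_isZero_right hY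

lemma middle_right (t : S.ETriangle A B Z) (hA : S.ExtSuccVanish n X A)
    (hZ : S.ExtSuccVanish n X Z) : S.ExtSuccVanish n X B :=
  EVanish.middle_right t hA hZ

lemma succ_iff_syzygy : S.ExtSuccVanish (n + 1) X Y ↔ S.EVanish (S.syzygy (S.syzygy^[n] X)) Y := by
  rw [ExtSuccVanish, Function.iterate_succ_apply']

variable [S.EnoughInjectives]

/-- Cosyzygies compute the same vanishing, which makes arguments in the first variable as easy as
those in the second. -/
lemma iff_cosyzygy : S.ExtSuccVanish n X Y ↔ S.EVanish X (S.cosyzygy^[n] Y) := by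
  induction n generalizing X with
  | zero => rfl
  | succ n ih =>
    rw [Function.iterate_succ_apply', ← EVanish.syzygy_iff, ← ih]
    rfl

lemma of_retract_left (h : S.ExtSuccVanish n X' Y) (i : X ⟶ X') (p : X' ⟶ X)
    (hip : i ≫ p = 𝟙 X) : S.ExtSuccVanish n X Y :=
  iff_cosyzygy.2 (EVanish.of_retract_left (iff_cosyzygy.1 h) i p hip)

lemma of_isZero_left (hX : IsZero X) : S.ExtSuccVanish n X Y :=
  iff_cosyzygy.2 (EVanish.of_isZero_left hX)

lemma middle_left (t : S.ETriangle A B Z) (hA : S.ExtSuccVanish n A Y)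
    (hZ : S.ExtSuccVanish n Z Y) : S.ExtSuccVanish n B Y :=
  iff_cosyzygy.2 (EVanish.middle_left t (iff_cosyzygy.1 hA) (iff_cosyzygy.1 hZ))

lemma succ_iff_cosyzygy :
    S.ExtSuccVanish (n + 1) X Y ↔ S.EVanish X (S.cosyzygy (S.cosyzygy^[n] Y)) := by
  rw [iff_cosyzygy, Function.iterate_succ_apply']

/-- Index n means degree n + 1. Pushing out along A → I with I injective gives a split triangle I →
M → Z, so Z is a summand of an extension of the cosyzygy of A by B. -/
lemma cone_right (t : S.ETriangle A B Z) (hB : S.ExtSuccVanish n X B)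
    (hA : S.ExtSuccVanish (n + 1) X A) : S.ExtSuccVanish n X Z := by
  obtain ⟨I, hI, tA⟩ := exists_cosyzygy_triangle (S := S) A
  obtain ⟨M, hM, hM'⟩ := t.exists_pushout tA
  rw [succ_iff_syzygy, EVanish.syzygy_iff] at hA
  obtain ⟨i⟩ := hM'.iso_biprod (EVanish.of_injective hI)
  exact EVanish.of_retract_right (EVanish.middle_right hM hB hA) (biprod.inr ≫ i.inv)
    (i.hom ≫ biprod.snd) (by simp)

/-- Composing A → B with B → I makes an extension of the cosyzygy of B by Z serve as a cosyzygy of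
A. -/
lemma cocone_right (t : S.ETriangle A B Z) (hZ : S.ExtSuccVanish n X Z)
    (hB : S.ExtSuccVanish (n + 1) X B) : S.ExtSuccVanish (n + 1) X A := by
  obtain ⟨I, hI, tB⟩ := exists_cosyzygy_triangle (S := S) B
  obtain ⟨P, hP, tX⟩ := exists_syzygy_triangle (S := S) (S.syzygy^[n] X)
  obtain ⟨H, hH, hH'⟩ := t.comp tB
  rw [succ_iff_syzygy, EVanish.syzygy_iff] at hB
  rw [succ_iff_syzygy, EVanish.shift_iff tX hP hH hI]
  exact EVanish.middle_right hH' hZ hB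

lemma cocone_left (t : S.ETriangle A B Z) (hB : S.ExtSuccVanish n B Y)
    (hZ : S.ExtSuccVanish (n + 1) Z Y) : S.ExtSuccVanish n A Y := by
  obtain ⟨P, hP, tZ⟩ := exists_syzygy_triangle (S := S) Z
  obtain ⟨M, hM, hM'⟩ := t.exists_pullback tZ
  rw [succ_iff_cosyzygy, ← EVanish.syzygy_iff] at hZ
  obtain ⟨i⟩ := hM.iso_biprod (EVanish.of_projective hP)
  exact iff_cosyzygy.2 (EVanish.of_retract_left (EVanish.middle_left hM' hZ (iff_cosyzygy.1 hB))
    (biprod.inl ≫ i.inv) (i.hom ≫ biprod.fst) (by simp))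

end ExtSuccVanish

end Higher

end ExtriangulatedStructure

/-! ### Orthogonal classes and closure properties of _ωX. -/

namespace IsAdditiveSubcategory

variable {C : Type u} [Category.{v} C] [Preadditive C] [HasZeroObject C] [HasFiniteBiproducts C]
  {P Q : ObjectProperty C}

lemma inf (hP : IsAdditiveSubcategory P) (hQ : IsAdditiveSubcategory Q) :
    IsAdditiveSubcategory (P ⊓ Q) where
  iso e h := ⟨hP.iso e h.1, hQ.iso e h.2⟩
  zero h := ⟨hP.zero h, hQ.zero h⟩
  biprod h h' := ⟨hP.biprod h.1 h'.1, hQ.biprod h.2 h'.2⟩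
  summand h := ⟨hP.summand h.1, hQ.summand h.2⟩

lemma summand_right (hP : IsAdditiveSubcategory P) {X Y : C} (h : P (X ⊞ Y)) : P Y :=
  hP.summand (hP.iso (biprod.braiding X Y) h)

end IsAdditiveSubcategory

namespace ExtriangulatedStructure

variable {C : Type u} [Category.{v} C] [Preadditive C] [HasZeroObject C] [HasFiniteBiproducts C]
  {S : ExtriangulatedStructure.{w} C} [S.EnoughProjectives]

section Perp

variable [S.EnoughInjectives] {ω : ObjectProperty C} {A B Z : C}

lemma isAdditiveSubcategory_leftPerp (ω : ObjectProperty C) :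
    IsAdditiveSubcategory (S.leftPerp ω) where
  iso e h Y hY n := ExtSuccVanish.of_retract_left (h Y hY n) e.inv e.hom (by simp)
  zero h Y hY n := ExtSuccVanish.of_isZero_left h
  biprod h h' Y hY n :=
    ExtSuccVanish.middle_left (ETriangle.biprod _ _) (h Y hY n) (h' Y hY n)
  summand h Y hY n := ExtSuccVanish.of_retract_left (h Y hY n) biprod.inl biprod.fst (by simp)

lemma leftPerp_middle (t : S.ETriangle A B Z) (hA : S.leftPerp ω A) (hZ : S.leftPerp ω Z) :
    S.leftPerp ω B :=
  fun Y hY n => ExtSuccVanish.middle_left t (hA Y hY n) (hZ Y hY n)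

omit [S.EnoughInjectives] in
lemma rightPerp_middle (t : S.ETriangle A B Z) (hA : S.rightPerp ω A) (hZ : S.rightPerp ω Z) :
    S.rightPerp ω B :=
  fun X hX n => ExtSuccVanish.middle_right t (hA X hX n) (hZ X hX n)

end Perp

namespace ProperResolved

variable {ω : ObjectProperty C} {A B Z M N : C}

lemma rightPerp (h : S.ProperResolved ω M) : S.rightPerp ω M := by
  obtain ⟨K, W, rfl, h⟩ := h
  exact (h 0).2.1

lemma exists_triangle (h : S.ProperResolved ω M) :
    ∃ K W, ω W ∧ S.ProperResolved ω K ∧ S.ETriangle K W M := by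
  obtain ⟨K, W, rfl, h⟩ := h
  exact ⟨K 1, W 0, (h 0).1, ⟨fun n => K (n + 1), fun n => W (n + 1), rfl, fun n => h (n + 1)⟩,
    (h 0).2.2⟩

/-- Coinduction principle for `_ωX`. -/
lemma of_invariant (P : ObjectProperty C)
    (h : ∀ M, P M → S.rightPerp ω M ∧ ∃ K W, ω W ∧ P K ∧ S.ETriangle K W M) :
    P ≤ S.ProperResolved ω := by
  intro M hM
  choose h1 K W hW hK ht using h
  let next : {M // P M} → {M // P M} := fun M => ⟨K M.1 M.2, hK M.1 M.2⟩
  let s : ℕ → {M // P M} := fun n => next^[n] ⟨M, hM⟩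
  refine ⟨fun n => (s n).1, fun n => W (s n).1 (s n).2, rfl, fun n => ⟨hW _ _, h1 _ (s n).2, ?_⟩⟩
  have : s (n + 1) = next (s n) := Function.iterate_succ_apply' _ _ _
  change S.ETriangle (s (n + 1)).1 _ _
  rw [this]
  exact ht _ _

lemma of_mem (hω : IsAdditiveSubcategory ω) (hself : S.SelfOrthogonal ω) (hM : ω M) :
    S.ProperResolved ω M :=
  of_invariant ω (fun M hM => ⟨hself M hM, 0, M, hM, hω.zero (isZero_zero C),
    ETriangle.id_right M⟩) M hM

/-- `_ωX` is closed under extensions. -/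
lemma middle (hω : IsAdditiveSubcategory ω) (t : S.ETriangle A B Z) (hA : S.ProperResolved ω A)
    (hZ : S.ProperResolved ω Z) : S.ProperResolved ω B := by
  refine of_invariant (fun M => ∃ A Z, S.ProperResolved ω A ∧ S.ProperResolved ω Z ∧
    S.ETriangle A M Z) ?_ B ⟨A, Z, hA, hZ, t⟩
  rintro M ⟨A, Z, hA, hZ, t⟩
  refine ⟨rightPerp_middle t hA.rightPerp hZ.rightPerp, ?_⟩
  obtain ⟨K, W, hW, hK, tA⟩ := hA.exists_triangle
  obtain ⟨K', W', hW', hK', tZ⟩ := hZ.exists_triangle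
  obtain ⟨L, hL, hL'⟩ := t.horseshoe tA tZ (hA.rightPerp W' hW' 0)
  exact ⟨L, W ⊞ W', hω.biprod hW hW', ⟨K, K', hK, hK', hL'⟩, hL⟩

lemma of_iso (hω : IsAdditiveSubcategory ω) (hself : S.SelfOrthogonal ω) (e : M ≅ N)
    (h : S.ProperResolved ω M) : S.ProperResolved ω N :=
  middle hω ((ETriangle.id_right M).of_iso (.refl _) e (.refl _))
    (of_mem hω hself (hω.zero (isZero_zero C))) h

/-- `_ωX` is closed under direct summands. -/
lemma summand (hω : IsAdditiveSubcategory ω) (h : S.ProperResolved ω (M ⊞ N)) :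
    S.ProperResolved ω M := by
  refine of_invariant (fun M => ∃ N, S.ProperResolved ω (M ⊞ N)) ?_ M ⟨N, h⟩
  rintro M ⟨N, h⟩
  refine ⟨fun X hX n => ExtSuccVanish.of_retract_right (h.rightPerp X hX n) biprod.inl biprod.fst
    (by simp), ?_⟩
  obtain ⟨K, W, hW, hK, t⟩ := h.exists_triangle
  -- H is the kernel of W → M ⊞ N → M and an extension of N by K. Its complement is M: H ⊞ M is an
  -- extension of N ⊞ M by K.
  obtain ⟨H, hH, hH'⟩ := t.comp_op
    ((ETriangle.biprod N M).of_iso (.refl _) (biprod.braiding N M) (.refl _))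
  refine ⟨H, W, hW, ⟨M, ?_⟩, hH⟩
  exact middle hω ((hH'.sum (ETriangle.id_right M)).of_iso
    (isoBiprodZero (isZero_zero C)).symm (.refl _) (biprod.braiding N M)) hK h

end ProperResolved

/-! ### Finite (co)resolutions and the tilting pair. -/

variable [S.EnoughInjectives] {𝒞 𝒟 ω : ObjectProperty C}

/-- Each 𝒟-term is orthogonal to W, so every step of the coresolution shifts the degree by one. -/
lemma CheckLE.extSuccVanish {n : ℕ} {M W : C} (h : S.CheckLE 𝒟 n M) (hW : S.leftPerp 𝒟 W)
    {m : ℕ} (hm : n ≤ m) : S.ExtSuccVanish m W M := by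
  induction n generalizing M m with
  | zero => exact hW M h m
  | succ n ih =>
    obtain ⟨D, K, hD, hK, t⟩ := h
    obtain ⟨m, rfl⟩ : ∃ k, m = k + 1 := ⟨m - 1, by omega⟩
    exact ExtSuccVanish.cocone_right t (ih hK (by omega)) (hW D hD _)

lemma CheckLE.extVanish {n : ℕ} {M Y : C} (h : S.CheckLE ω n M) (hY : S.rightPerp ω Y) :
    S.ExtVanish M Y := by
  induction n generalizing M with
  | zero => exact hY M h
  | succ n ih =>
    obtain ⟨W, K, hW, hK, t⟩ := h
    exact fun i => ExtSuccVanish.cocone_left t (hY W hW i) (ih hK (i + 1))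

omit [S.EnoughInjectives] in
lemma FiniteFiltration.extSuccVanish {𝒮 : Set C} {M W : C} {n : ℕ} (h : S.FiniteFiltration 𝒮 M)
    (h𝒮 : ∀ T ∈ 𝒮, S.ExtSuccVanish n W T) : S.ExtSuccVanish n W M := by
  induction h with
  | single hZ hT t => exact ExtSuccVanish.middle_right t (ExtSuccVanish.of_isZero_right hZ) (h𝒮 _ hT)
  | step _ hT t ih => exact ExtSuccVanish.middle_right t ih (h𝒮 _ hT)

/-- An object of `_𝒞X` of finite projective dimension relative to `_𝒞X` has a finite
`𝒞`-resolution. -/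
lemma hatLE_of_extSuccVanish (h𝒞 : IsAdditiveSubcategory 𝒞) {n : ℕ} {M : C}
    (hM : S.ProperResolved 𝒞 M)
    (h : ∀ Y, S.ProperResolved 𝒞 Y → S.ExtSuccVanish n M Y) : S.HatLE 𝒞 n M := by
  induction n generalizing M with
  | zero =>
    obtain ⟨K, W, hW, hK, t⟩ := hM.exists_triangle
    obtain ⟨e⟩ := t.iso_biprod (h K hK)
    exact h𝒞.summand_right (h𝒞.iso e hW)
  | succ n ih =>
    obtain ⟨K, W, hW, hK, t⟩ := hM.exists_triangle
    exact ⟨K, W, hW, ih hK fun Y hY =>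
      ExtSuccVanish.cocone_left t (hY.rightPerp W hW n) (h Y hY), t⟩

variable {𝒳 : ObjectProperty C}

/-- An object of `^⊥𝒟` of finite injective dimension relative to `^⊥𝒟` has a finite coresolution
by objects of `^⊥𝒟 ∩ 𝒟`. -/
lemma checkLE_of_extSuccVanish (h𝒟 : IsAdditiveSubcategory 𝒟)
    (happ : ∀ M, 𝒳 M → ∃ D V, S.ETriangle M D V ∧ 𝒟 D ∧ 𝒳 V ∧ S.leftPerp 𝒟 V) {n : ℕ} {M : C}
    (hM : 𝒳 M) (hM' : S.leftPerp 𝒟 M)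
    (h : ∀ W, 𝒳 W → S.leftPerp 𝒟 W → S.ExtSuccVanish n W M) :
    S.CheckLE (S.leftPerp 𝒟 ⊓ 𝒟) n M := by
  induction n generalizing M with
  | zero =>
    obtain ⟨D, V, t, hD, hV, hV'⟩ := happ M hM
    obtain ⟨e⟩ := t.iso_biprod (h V hV hV')
    exact ⟨hM', h𝒟.summand (h𝒟.iso e hD)⟩
  | succ n ih =>
    obtain ⟨D, V, t, hD, hV, hV'⟩ := happ M hM
    exact ⟨D, V, ⟨leftPerp_middle t hM' hV', hD⟩, ih hV hV' fun W hW hW' =>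
      ExtSuccVanish.cone_right t (hW' D hD n) (h W hW hW'), t⟩

/-- The main theorem, given special left `𝒟`-approximations. -/
lemma isTiltingPair_of_special_approximations (h𝒞 : IsAdditiveSubcategory 𝒞)
    (h𝒞_self : S.SelfOrthogonal 𝒞) (hfilt : S.FinitelyFiltered (S.Check (S.ProperResolved 𝒞)))
    (h𝒟 : S.IsRelCoresolving 𝒟 (S.ProperResolved 𝒞))
    (happ : ∀ M, S.ProperResolved 𝒞 M →
      ∃ D V, S.ETriangle M D V ∧ 𝒟 D ∧ S.ProperResolved 𝒞 V ∧ S.leftPerp 𝒟 V)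
    (hcheck : S.Check 𝒟 = S.Check (S.ProperResolved 𝒞)) :
    S.IsTiltingPair 𝒞 (S.leftPerp 𝒟 ⊓ 𝒟) ∧ 𝒟 = S.ProperResolved (S.leftPerp 𝒟 ⊓ 𝒟) := by
  set ω := S.leftPerp 𝒟 ⊓ 𝒟 with hωdef
  have hω : IsAdditiveSubcategory ω :=
    (isAdditiveSubcategory_leftPerp 𝒟).inf h𝒟.isSubcategory
  have hωself : S.SelfOrthogonal ω := fun Y hY X hX => hX.1 Y hY.2
  have h𝒞𝒟 : 𝒞 ≤ S.leftPerp 𝒟 := fun X hX Y hY => (h𝒟.le Y hY).rightPerp X hX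
  have h𝒞𝒳 : 𝒞 ≤ S.ProperResolved 𝒞 := fun X hX => ProperResolved.of_mem h𝒞 h𝒞_self hX
  have hle : S.ProperResolved 𝒞 ≤ S.Check 𝒟 := fun M hM => by rw [hcheck]; exact ⟨0, hM⟩
  have hcheckω : ∀ M, S.ProperResolved 𝒞 M → S.leftPerp 𝒟 M → S.Check ω M := fun M hM hM' => by
    obtain ⟨n, hn⟩ := hle M hM
    exact ⟨n, checkLE_of_extSuccVanish h𝒟.isSubcategory happ hM hM' fun W _ hW =>
      hn.extSuccVanish hW le_rfl⟩
  have h𝒞ω : 𝒞 ≤ S.Check ω := fun M hM => hcheckω M (h𝒞𝒳 M hM) (h𝒞𝒟 M hM)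
  have hωhat : ω ≤ S.Hat 𝒞 := fun W hW => by
    obtain ⟨𝒮, h𝒮, h𝒮', hS⟩ := hfilt
    rw [← hcheck] at h𝒮' hS
    choose! N hN using h𝒮'
    -- Finiteness of `𝒮` gives one bound for all coresolution lengths, and filtrations pass the
    -- vanishing on to all of 𝒳.
    obtain ⟨n, hn⟩ := (h𝒮.image N).bddAbove
    exact ⟨n, hatLE_of_extSuccVanish h𝒞 (h𝒟.le W hW.2) fun Y hY =>
      (hS Y (hle Y hY)).extSuccVanish fun T hT =>
        (hN T hT).extSuccVanish hW.1 (hn ⟨T, hT, rfl⟩)⟩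
  refine ⟨⟨h𝒞, hω, h𝒞_self, hωself, hωhat, h𝒞ω⟩, le_antisymm ?_ ?_⟩
  · refine ProperResolved.of_invariant 𝒟 fun M hM => ⟨fun X hX => hX.1 M hM, ?_⟩
    obtain ⟨K, W, hW, hK, t⟩ := (h𝒟.le M hM).exists_triangle
    obtain ⟨D, V, t', hD, hV, hV'⟩ := happ K hK
    -- Q is in ω: in ^⊥𝒟 as an extension of V by W, in 𝒟 as an extension of M by D.
    obtain ⟨Q, hQ, hQ'⟩ := t.exists_pushout t'
    exact ⟨D, Q, ⟨leftPerp_middle hQ (h𝒞𝒟 W hW) hV', h𝒟.extension hQ' hD hM⟩, hD, hQ'⟩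
  · have hperp : ∀ M, S.ProperResolved ω M → S.rightPerp 𝒞 M := fun M hM X hX => by
      obtain ⟨n, hn⟩ := h𝒞ω X hX
      exact hn.extVanish hM.rightPerp
    have hle𝒳 : ∀ M, S.ProperResolved ω M → S.ProperResolved 𝒞 M := by
      have hstep : ∀ M, S.ProperResolved ω M → ∃ H W L K, S.ETriangle H W M ∧ 𝒞 W ∧
          S.ETriangle L H K ∧ S.ProperResolved 𝒞 L ∧ S.ProperResolved ω K := fun M hM => by
        obtain ⟨K, W, hW, hK, t⟩ := hM.exists_triangle
        obtain ⟨L, U, hU, hL, t'⟩ := (h𝒟.le W hW.2).exists_triangle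
        obtain ⟨H, hH, hH'⟩ := t'.comp_op t
        exact ⟨H, U, L, K, hH, hU, hH', hL, hK⟩
      intro M hM
      -- The kernel of a 𝒞-cover built through an ω-cover may leave _ωX, but it is an extension of
      -- an object of _ωX by one of 𝒳; this larger class is stable under the step.
      refine ProperResolved.of_invariant (fun M => ∃ L K, S.ProperResolved 𝒞 L ∧
        S.ProperResolved ω K ∧ S.ETriangle L M K) ?_ M
        ⟨0, M, h𝒞𝒳 _ (h𝒞.zero (isZero_zero C)), hM, ETriangle.id_right M⟩
      rintro M ⟨L, K, hL, hK, t⟩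
      refine ⟨rightPerp_middle t hL.rightPerp (hperp K hK), ?_⟩
      obtain ⟨L₁, W, hW, hL₁, tL⟩ := hL.exists_triangle
      obtain ⟨H, U, L₂, K', tK, hU, tH, hL₂, hK'⟩ := hstep K hK
      obtain ⟨N, hN, hN'⟩ := t.horseshoe tL tK (hL.rightPerp U hU 0)
      obtain ⟨Q, hQ, hQ'⟩ := hN'.comp_op tH
      exact ⟨N, W ⊞ U, h𝒞.biprod hW hU, ⟨Q, K', ProperResolved.middle h𝒞 hQ' hL₁ hL₂, hK', hQ⟩, hN⟩
    intro M hM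
    obtain ⟨D, V, t, hD, hV, hV'⟩ := happ M (hle𝒳 M hM)
    obtain ⟨n, hn⟩ := hcheckω V hV hV'
    obtain ⟨e⟩ := t.iso_biprod (hn.extVanish hM.rightPerp 0)
    exact h𝒟.isSubcategory.summand (h𝒟.isSubcategory.iso e hD)

end ExtriangulatedStructure

/-! ### The radical of a Krull–Schmidt category. -/

section KrullSchmidt

/-- The condition describes the Jacobson radical; additivity follows by factoring out the unit `u =
1 + y * a`. -/
lemma isUnit_one_add_mul_sum {R ι : Type*} [Ring R] (s : Finset ι) (f : ι → R)
    (h : ∀ i ∈ s, ∀ y, IsUnit (1 + y * f i)) (y : R) : IsUnit (1 + y * ∑ i ∈ s, f i) := by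
  refine Finset.sum_induction f (fun x => ∀ y, IsUnit (1 + y * x)) ?_ (by simp) h y
  intro a b ha hb y
  obtain ⟨u, hu⟩ := ha y
  have h1 : 1 + y * (a + b) = u * (1 + (↑u⁻¹ * y) * b) := by
    rw [mul_add, mul_add, ← add_assoc, ← hu, mul_assoc, mul_one, u.mul_inv_cancel_left]
  rw [h1]
  exact u.isUnit.mul (hb _)

variable {C : Type u} [Category.{v} C] [Preadditive C]

lemma isIso_id_add_comp_swap {X Y : C} (a : X ⟶ Y) (b : Y ⟶ X) (h : IsIso (𝟙 Y + b ≫ a)) :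
    IsIso (𝟙 X + a ≫ b) := by
  obtain ⟨c, h1, h2⟩ := h
  simp only [Preadditive.add_comp, Preadditive.comp_add, Category.id_comp, Category.comp_id,
    Category.assoc] at h1 h2
  have h1' : b ≫ a ≫ c = 𝟙 Y - c := eq_sub_of_add_eq' h1
  have h2' : c ≫ b ≫ a = 𝟙 Y - c := eq_sub_of_add_eq' h2
  have h1'' := congrArg (fun t => a ≫ t ≫ b) h1'
  have h2'' := congrArg (fun t => a ≫ t ≫ b) h2'
  simp only [Category.assoc, Preadditive.sub_comp, Preadditive.comp_sub, Category.id_comp]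
    at h1'' h2''
  refine ⟨𝟙 X - a ≫ c ≫ b, ?_, ?_⟩
  · simp [Preadditive.add_comp, Preadditive.comp_sub, h1'']
  · simp [Preadditive.sub_comp, Preadditive.comp_add, h2'']

lemma isIso_or_isIso_of_add_eq_id {X : C} [IsLocalRing (End X)] (p q : X ⟶ X)
    (h : p + q = 𝟙 X) : IsIso p ∨ IsIso q := by
  rw [← isUnit_iff_isIso, ← isUnit_iff_isIso]
  exact IsLocalRing.isUnit_or_isUnit_of_add_one (R := End X) h

/-- Non-isomorphisms between objects with local endomorphism rings belong to the radical. -/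
lemma isIso_id_add_comp_of_not_isIso {X Y : C} [IsLocalRing (End X)] [IsLocalRing (End Y)]
    (a : X ⟶ Y) (ha : ¬ IsIso a) (b : Y ⟶ X) : IsIso (𝟙 X + a ≫ b) := by
  by_contra hn
  have h1 : IsIso (a ≫ b) := by
    have h := (isIso_or_isIso_of_add_eq_id (𝟙 X + a ≫ b) (-(a ≫ b)) (by simp)).resolve_left hn
    exact ⟨-inv (-(a ≫ b)), by
      rw [Preadditive.comp_neg, ← Preadditive.neg_comp, IsIso.hom_inv_id], by
      rw [Preadditive.neg_comp, ← Preadditive.comp_neg, IsIso.inv_hom_id]⟩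
  have hm : IsSplitMono a := ⟨⟨⟨b ≫ inv (a ≫ b), by rw [← Category.assoc, IsIso.hom_inv_id]⟩⟩⟩
  -- This idempotent of the local ring End Y is invertible, making `a` an isomorphism, or its
  -- complement is, forcing `a = 0`.
  rcases isIso_or_isIso_of_add_eq_id (b ≫ inv (a ≫ b) ≫ a) (𝟙 Y - b ≫ inv (a ≫ b) ≫ a)
    (by simp) with h | h
  · have : IsSplitEpi a := ⟨⟨⟨inv (b ≫ inv (a ≫ b) ≫ a) ≫ b ≫ inv (a ≫ b), by
      simpa only [Category.assoc] using IsIso.inv_hom_id (b ≫ inv (a ≫ b) ≫ a)⟩⟩⟩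
    exact ha (isIso_of_mono_of_isSplitEpi a)
  · have ha0 : a ≫ (𝟙 Y - b ≫ inv (a ≫ b) ≫ a) = 0 := by
      rw [Preadditive.comp_sub, ← Category.assoc a b, IsIso.hom_inv_id_assoc]; simp
    have ha0 : a = 0 := by
      rw [← Category.comp_id a, ← IsIso.hom_inv_id (𝟙 Y - b ≫ inv (a ≫ b) ≫ a),
        ← Category.assoc, ha0, zero_comp]
    have : 𝟙 X = 0 := by
      rw [← IsIso.hom_inv_id (a ≫ b), Category.assoc]
      generalize b ≫ inv (a ≫ b) = c
      rw [ha0, zero_comp]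
    exact one_ne_zero (α := End X) this

variable [HasFiniteBiproducts C]

/-- If no component of `h` is invertible, then `1 - h` is. -/
lemma isIso_of_not_isIso_components {n : ℕ} {f : Fin n → C} (hf : ∀ i, IsLocalRing (End (f i)))
    (h : ⨁ f ⟶ ⨁ f) (hh : ∀ i j, ¬ IsIso (biproduct.ι f i ≫ h ≫ biproduct.π f j)) :
    IsIso (𝟙 _ - h) := by
  have hsum : h = ∑ p : Fin n × Fin n, biproduct.π f p.1 ≫
      (biproduct.ι f p.1 ≫ h ≫ biproduct.π f p.2) ≫ biproduct.ι f p.2 := by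
    rw [Fintype.sum_prod_type]
    simp only [Category.assoc, ← Preadditive.comp_sum]
    simp only [biproduct.total, Category.comp_id]
    simp only [← Category.assoc, ← Preadditive.sum_comp]
    simp
  have key := isUnit_one_add_mul_sum (R := End (⨁ f)) Finset.univ
    (fun p : Fin n × Fin n => biproduct.π f p.1 ≫
      (biproduct.ι f p.1 ≫ h ≫ biproduct.π f p.2) ≫ biproduct.ι f p.2) (fun p _ y => by
        have := hf p.1
        have := hf p.2
        rw [isUnit_iff_isIso]
        have := isIso_id_add_comp_swap (biproduct.π f p.1)
          ((biproduct.ι f p.1 ≫ h ≫ biproduct.π f p.2) ≫ biproduct.ι f p.2 ≫ y) (by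
            simpa only [Category.assoc] using isIso_id_add_comp_of_not_isIso _ (hh p.1 p.2)
              (biproduct.ι f p.2 ≫ y ≫ biproduct.π f p.1))
        simpa only [Category.assoc, End.mul_def, End.one_def] using this) (-1)
  rw [neg_one_mul, ← sub_eq_add_neg] at key
  rw [hsum]
  exact (isUnit_iff_isIso _).1 key

end KrullSchmidt

/-! ### Minimal approximations and Wakamatsu's lemma. -/

namespace ExtriangulatedStructure

variable {C : Type u} [Category.{v} C] [Preadditive C] [HasZeroObject C] [HasFiniteBiproducts C]
  {S : ExtriangulatedStructure.{w} C} {𝒟 𝒳 : ObjectProperty C}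

/-- If `r` splits the `i`-th inclusion and vanishes on `M`, the `i`-th summand can be removed. -/
lemma Realizes.exists_smaller (hWIC : S.WeaklyIdempotentComplete) {M V : C} {n : ℕ}
    {f : Fin (n + 1) → C} {δ : EExtension S.E V M} {g : M ⟶ ⨁ f} {y : ⨁ f ⟶ V}
    (t : S.Realizes δ g y) (i : Fin (n + 1)) (r : ⨁ f ⟶ f i)
    (hr : biproduct.ι f i ≫ r = 𝟙 _) (hg : g ≫ r = 0) :
    ∃ (V' : C) (δ' : EExtension S.E V' M) (g' : M ⟶ ⨁ (f ∘ i.succAbove))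
      (y' : ⨁ (f ∘ i.succAbove) ⟶ V') (j : ⨁ (f ∘ i.succAbove) ⟶ ⨁ f),
      S.Realizes δ' g' y' ∧ g' ≫ j = g ∧ Nonempty (V ≅ V' ⊞ f i) ∧
      Nonempty (⨁ f ≅ (⨁ (f ∘ i.succAbove)) ⊞ f i) := by
  let q : ⨁ f ⟶ ⨁ (f ∘ i.succAbove) := biproduct.lift fun k => biproduct.π f (i.succAbove k)
  let e : ⨁ (f ∘ i.succAbove) ⟶ ⨁ f := biproduct.desc fun k => biproduct.ι f (i.succAbove k)
  have heq : e ≫ q = 𝟙 _ := by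
    ext k l
    by_cases hkl : k = l
    · subst hkl; simp [e, q]
    · simpa [e, q, biproduct.ι_π_ne (f ∘ i.succAbove) (Ne.symm hkl)] using
        biproduct.ι_π_ne f (fun h => hkl (Fin.succAbove_right_injective h).symm)
  have hiq : biproduct.ι f i ≫ q = 0 := by
    ext l
    simp [q, biproduct.ι_π_ne f (Fin.succAbove_ne i l).symm]
  have htot : biproduct.π f i ≫ biproduct.ι f i + q ≫ e = 𝟙 _ := by
    rw [← biproduct.total, Fin.sum_univ_succAbove _ i]
    simp [q, e, biproduct.lift_desc]
  -- The inclusion `e` is corrected to land in the kernel of `r`, so that `g` factors through `j`.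
  let j : ⨁ (f ∘ i.succAbove) ⟶ ⨁ f := e - e ≫ r ≫ biproduct.ι f i
  have hqe : q ≫ e = 𝟙 _ - biproduct.π f i ≫ biproduct.ι f i := eq_sub_of_add_eq' htot
  have hjq : j ≫ q = 𝟙 _ := by simp [j, heq, hiq]
  have hjr : j ≫ r = 0 := by simp [j, hr]
  have htot' : q ≫ j + r ≫ biproduct.ι f i = 𝟙 _ := by
    simp only [j, Preadditive.comp_sub, reassoc_of% hqe, hqe]
    simp [reassoc_of% hr]
  have hsplit : S.Realizes 0 j r := realizes_zero_of_split j r q _ hjq hr hjr htot'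
  have hgj : (g ≫ q) ≫ j = g := by
    have h0 : g ≫ (q ≫ j + r ≫ biproduct.ι f i) = g := by rw [htot', Category.comp_id]
    simpa [reassoc_of% hg] using h0
  -- (WIC) enters here: `(g ≫ q) ≫ j = g` is an inflation, hence so is `g ≫ q`.
  obtain ⟨V', y', δ', t'⟩ := hWIC.1 (g ≫ q) j ⟨V, y, δ, by rwa [hgj]⟩
  obtain ⟨H, k, k', d, d', δ'', hk, -, -, h1, h2, -⟩ := S.et4 t' hsplit
  rw [← hk, hgj] at h1
  rw [EExtension.push_zero] at h2
  obtain ⟨e₁⟩ := t.cone_iso h1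
  obtain ⟨e₂⟩ := h2.middle_iso (S.realizes_zero V' (f i))
  obtain ⟨e₃⟩ := hsplit.middle_iso (S.realizes_zero _ (f i))
  exact ⟨V', δ', g ≫ q, y', j, t', hgj, ⟨e₁ ≪≫ e₂⟩, ⟨e₃⟩⟩

/-- Left `𝒟`-approximations with cone in `𝒳` can be chosen left minimal. -/
lemma exists_minimal_approximation (hKS : IsKrullSchmidtCategory C)
    (hWIC : S.WeaklyIdempotentComplete) (h𝒟 : IsAdditiveSubcategory 𝒟)
    (h𝒳iso : ∀ {V V' : C}, (V ≅ V') → 𝒳 V → 𝒳 V') (h𝒳sum : ∀ {V V' : C}, 𝒳 (V ⊞ V') → 𝒳 V)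
    {M : C} (h : ∃ (D V : C) (δ : EExtension S.E V M) (g : M ⟶ D) (y : D ⟶ V),
      S.Realizes δ g y ∧ 𝒟 D ∧ 𝒳 V ∧ ∀ (D' : C) (g' : M ⟶ D'), 𝒟 D' → ∃ t : D ⟶ D', g ≫ t = g') :
    ∃ (D V : C) (δ : EExtension S.E V M) (g : M ⟶ D) (y : D ⟶ V),
      S.Realizes δ g y ∧ 𝒟 D ∧ 𝒳 V ∧
      (∀ (D' : C) (g' : M ⟶ D'), 𝒟 D' → ∃ t : D ⟶ D', g ≫ t = g') ∧
      ∀ t : D ⟶ D, g ≫ t = g → IsIso t := by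
  -- Minimality is reached by taking the fewest local summands: a non-invertible `s` fixing `g`
  -- would let one be removed.
  let Q : ℕ → Prop := fun n => ∃ (f : Fin n → C) (V : C) (δ : EExtension S.E V M) (g : M ⟶ ⨁ f)
    (y : ⨁ f ⟶ V), (∀ i, IsLocalRing (End (f i))) ∧ S.Realizes δ g y ∧ 𝒟 (⨁ f) ∧ 𝒳 V ∧
      ∀ (D' : C) (g' : M ⟶ D'), 𝒟 D' → ∃ t : ⨁ f ⟶ D', g ≫ t = g'
  have hQ : ∃ n, Q n := by
    obtain ⟨D, V, δ, g, y, t, hD, hV, happ⟩ := h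
    obtain ⟨n, f, hf, ⟨e⟩⟩ := hKS D
    refine ⟨n, f, V, δ, g ≫ e.hom, e.inv ≫ y, hf, (S.realizes_iff t _ _).2 ⟨e, rfl, by simp⟩,
      h𝒟.iso e hD, hV, fun D' g' hD' => ?_⟩
    obtain ⟨s, hs⟩ := happ D' g' hD'
    exact ⟨e.inv ≫ s, by simpa using hs⟩
  classical
  obtain ⟨f, V, δ, g, y, hf, t, hD, hV, happ⟩ := Nat.find_spec hQ
  have hmin := fun m => Nat.find_min (m := m) hQ
  generalize Nat.find hQ = n at *
  refine ⟨⨁ f, V, δ, g, y, t, hD, hV, happ, fun s hs => ?_⟩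
  by_contra hn
  obtain ⟨i, k, hik⟩ : ∃ i k, IsIso (biproduct.ι f i ≫ (𝟙 _ - s) ≫ biproduct.π f k) := by
    by_contra! hc
    have := isIso_of_not_isIso_components hf (𝟙 _ - s) hc
    rw [sub_sub_cancel] at this
    exact hn this
  obtain _ | n := n
  · exact i.elim0
  obtain ⟨V', δ', g', y', j, t', hj, ⟨e⟩, ⟨e'⟩⟩ := t.exists_smaller hWIC i
    ((𝟙 _ - s) ≫ biproduct.π f k ≫ inv (biproduct.ι f i ≫ (𝟙 _ - s) ≫ biproduct.π f k))
    (by simpa only [Category.assoc] using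
      IsIso.hom_inv_id (biproduct.ι f i ≫ (𝟙 _ - s) ≫ biproduct.π f k))
    (by rw [← Category.assoc, Preadditive.comp_sub, hs, Category.comp_id, sub_self, zero_comp])
  refine hmin n (Nat.lt_succ_self n) ⟨_, V', δ', g', y', fun l => hf _, t',
    h𝒟.summand (h𝒟.iso e' hD), h𝒳sum (h𝒳iso e hV), fun D' u hD' => ?_⟩
  obtain ⟨w, hw⟩ := happ D' u hD'
  exact ⟨j ≫ w, by rw [reassoc_of% hj, hw]⟩

/-- Wakamatsu's lemma: the cone of a left minimal `𝒟`-approximation is `E`-orthogonal to `𝒟`. -/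
lemma Realizes.wakamatsu (hext : ∀ {A B Z : C}, S.ETriangle A B Z → 𝒟 A → 𝒟 Z → 𝒟 B)
    {M D V : C} {δ : EExtension S.E V M} {g : M ⟶ D} {y : D ⟶ V} (t : S.Realizes δ g y)
    (hD : 𝒟 D) (happ : ∀ (D' : C) (g' : M ⟶ D'), 𝒟 D' → ∃ t : D ⟶ D', g ≫ t = g')
    (hmin : ∀ t : D ⟶ D, g ≫ t = g → IsIso t) {D' : C} (hD' : 𝒟 D') : S.EVanish V D' := by
  intro θ
  have h0 : θ.pull y = 0 := by
    obtain ⟨N, a, b, hN⟩ := S.exists_realizes (θ.pull y)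
    -- N is in 𝒟, so the lift of `g` to N factors through `g`; minimality makes D → N → D
    -- invertible, which splits the pulled-back triangle.
    obtain ⟨l, hl⟩ := hN.exists_lift g (by
      rw [← EExtension.pull_comp, t.comp_eq_zero, S.zero_pull])
    obtain ⟨s, hs⟩ := happ N l (hext ⟨_, _, _, hN⟩ hD' hD)
    have := hmin (s ≫ b) (by rw [reassoc_of% hs, hl])
    have h1 : (θ.pull y).pull (s ≫ b) = 0 := by
      rw [EExtension.pull_comp, hN.pull_eq_zero, EExtension.pull_zero]
    rw [← EExtension.pull_id (θ.pull y), ← IsIso.inv_hom_id (s ≫ b), EExtension.pull_comp, h1,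
      EExtension.pull_zero]
  obtain ⟨a, rfl⟩ := t.exists_push_eq θ h0
  obtain ⟨s, rfl⟩ := happ D' a hD'
  rw [EExtension.push_comp, t.push_eq_zero, EExtension.push_zero]

end ExtriangulatedStructure

open ExtriangulatedStructure in
theorem mainTheorem7 {C : Type u} [Category.{v} C] [Preadditive C] [HasZeroObject C]
    [HasFiniteBiproducts C] (S : ExtriangulatedStructure.{w} C)
    [S.EnoughProjectives] [S.EnoughInjectives]
    (hKS : IsKrullSchmidtCategory C) (hWIC : S.WeaklyIdempotentComplete)
    (𝒞 𝒟 : ObjectProperty C)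
    (h𝒞 : IsAdditiveSubcategory 𝒞) (h𝒞_self : S.SelfOrthogonal 𝒞)
    (hcogen : ∃ ℐ : ObjectProperty C, S.IsRelInjectiveCogenerator ℐ (S.ProperResolved 𝒞))
    (hfilt : S.FinitelyFiltered (S.Check (S.ProperResolved 𝒞)))
    (h𝒟 : S.IsRelCoresolving 𝒟 (S.ProperResolved 𝒞))
    (h𝒟_fin : S.StronglyCovariantlyFiniteIn 𝒟 (S.ProperResolved 𝒞))
    (hcheck : S.Check 𝒟 = S.Check (S.ProperResolved 𝒞)) :
    S.IsTiltingPair 𝒞 (S.leftPerp 𝒟 ⊓ 𝒟) ∧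
      𝒟 = S.ProperResolved (S.leftPerp 𝒟 ⊓ 𝒟) := by
  refine isTiltingPair_of_special_approximations h𝒞 h𝒞_self hfilt h𝒟 (fun M hM => ?_) hcheck
  obtain ⟨D, V, δ, g, y, t, hD, hV, happ, hmin⟩ := exists_minimal_approximation hKS hWIC
    h𝒟.isSubcategory (ProperResolved.of_iso h𝒞 h𝒞_self) (ProperResolved.summand h𝒞)
    (h𝒟_fin M hM)
  refine ⟨D, V, ⟨_, _, _, t⟩, hD, hV, fun D' hD' n => ?_⟩
  obtain ⟨ℐ, hℐ⟩ := hcogen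
  induction n generalizing D' with
  | zero => exact t.wakamatsu h𝒟.extension hD happ hmin hD'
  | succ n ih =>
    obtain ⟨I, Y, hI, hY, t'⟩ := hℐ.cogenerates D' (h𝒟.le D' hD')
    have hI𝒟 : 𝒟 I := h𝒟.injective I ⟨hℐ.le I hI, fun δ x y r _ _ hZ a =>
      r.exists_extend a (hℐ.le_rightPerp I hI _ hZ 0 _)⟩
    -- Y is in 𝒟 by closure under cones, so the induction hypothesis applies to it one degree lower.
    exact ExtSuccVanish.cocone_right t' (ih Y (h𝒟.cone t' hD' hI𝒟))
      (hℐ.le_rightPerp I hI V hV _)
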